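/- Let $T>0$, let $\mathcal O\subset\mathbb R$ be open with closure $\bar{\mathcal O}$, and let $A\subset\mathbb R$ be compact. Let $\mathcal S$ be the set of bounded measurable functions $h:[0,T]\times\bar{\mathcal O}\times A\to\mathbb R$ such that $h(t,\cdot)$ is continuous on $\bar{\mathcal O}\times A$ for each $t\in[0,T]$. Let $b:[0,T]\times\mathbb R\times A\to\mathbb R$ and $\sigma:[0,T]\times\mathbb R\times A\to[0,\infty)$ be measurable, bounded, Lipschitz in $x$ uniformly in $(t,a)$, and such that their restrictions to $[0,T]\times\bar{\mathcal O}\times A$ belong to $\mathcal S$. Let $m_0^*$ be a Borel probability measure on $\mathcal O$ with $\int_{\mathcal O}\ln(1+|x|)\,m_0^*(dx)<\infty$. Let $\mathcal P([0,T]\times\bar{\mathcal O})$ be the set of Borel probability measures on $[0,T]\times\bar{\mathcal O}$ with the topology of weak convergence. Let $V$ be the set of families $(m_t)_{t\in[0,T]}$ of finite positive Borel measures on $\bar{\mathcal O}\times A$ such that $t\mapsto m_t(B)$ is measurable for every Borel set $B$ and $\int_0^T m_t(\bar{\mathcal O}\times A)\,dt<\infty$, where two families that coincide for Lebesgue-almost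 every $t$ are identified; $V$ carries the topology of weak convergence of the finite measures $m_t(dx,da)\,dt$ on $[0,T]\times\bar{\mathcal O}\times A$. Let $C_b^{1,2}([0,T]\times\bar{\mathcal O})$ be the set of bounded continuous functions $u$ on $[0,T]\times\bar{\mathcal O}$ whose derivatives $\partial_t u,\partial_x u,\partial_{xx}u$ (taken within $[0,T]$ and $\bar{\mathcal O}$ respectively) exist and are bounded and continuous on $[0,T]\times\bar{\mathcal O}$. Let $\mathcal R$ be the set of pairs $(\mu,m)\in\mathcal P([0,T]\times\bar{\mathcal O})\times V$ such that for all $u\in C_b^{1,2}([0,T]\times\bar{\mathcal O})$, $$\int_{[0,T]\times\bar{\mathcal O}}u(t,x)\,\mu(dt,dx)=\int_{\mathcal O}u(0,x)\,m_0^*(dx)+\int_0^T\int_{\bar{\mathcal O}\times A}\Big(\frac{\partial u}{\partial t}+b\,\frac{\partial u}{\partial x}+\frac{\sigma^2}{2}\,\frac{\partial^2u}{\partial x^2}\Big)(t,x,a)\,m_t(dx,da)\,dt .$$ Then $\mathcal R$ is a compact subset of $\mathcal P([0,T]\times\bar{\mathcal O})\times V$ (with the product topology). -/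

import Mathlib

open MeasureTheory ProbabilityTheory Set
open scoped NNReal ENNReal

/-- Lebesgue measure `dt` on `[0,T]`. -/
noncomputable def timeMeasure (T : ℝ) : Measure (Icc (0 : ℝ) T) :=
  Measure.comap Subtype.val volume

instance (T : ℝ) : IsFiniteMeasure (timeMeasure T) where
  measure_univ_lt_top := by
    rw [timeMeasure, comap_subtype_coe_apply measurableSet_Icc, image_univ, Subtype.range_coe]
    exact measure_Icc_lt_top

/-- A measurable flow `(m_t)_{t ∈ [0,T]}` of finite positive Borel measures on `closure O × A` with
`∫_0^T m_t(closure O × A) dt < ∞`.  Being a `Kernel` says exactly that `t ↦ m_t(B)` is measurable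
for every Borel set `B`. -/
structure MeasureFlow (T : ℝ) (O A : Set ℝ) where
  /-- the map `t ↦ m_t` -/
  toKernel : Kernel (Icc (0 : ℝ) T) (closure O × A)
  isFiniteMeasure : ∀ t, IsFiniteMeasure (toKernel t)
  lintegral_lt_top : ∫⁻ t, toKernel t univ ∂(timeMeasure T) < ∞

namespace MeasureFlow

variable {T : ℝ} {O A : Set ℝ}

/-- Two flows are identified when `m¹_t = m²_t` for Lebesgue-almost every `t ∈ [0,T]`. -/
instance setoid (T : ℝ) (O A : Set ℝ) : Setoid (MeasureFlow T O A) where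
  r m₁ m₂ := ∀ᵐ t ∂(timeMeasure T), m₁.toKernel t = m₂.toKernel t
  iseqv :=
    { refl := fun _ => Filter.Eventually.of_forall fun _ => rfl
      symm := fun h => h.mono fun _ ht => ht.symm
      trans := fun h₁ h₂ => by filter_upwards [h₁, h₂] with t h h' using h.trans h' }

/-- The kernel of a flow is s-finite (so that the measure `m_t(dx,da) dt` below is not a junk
value): cut `[0,T]` along the values of `⌊m_t(closure O × A)⌋`. -/
instance isSFiniteKernel (m : MeasureFlow T O A) : IsSFiniteKernel m.toKernel := by
  classical
  have hmeas : Measurable fun t => m.toKernel t univ :=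
    m.toKernel.measurable_coe MeasurableSet.univ
  let f : Icc (0 : ℝ) T → ℕ := fun t => ⌊(m.toKernel t univ).toNNReal⌋₊
  have hf : Measurable f := Nat.measurable_floor.comp hmeas.ennreal_toNNReal
  have hs : ∀ n, MeasurableSet (f ⁻¹' {n}) := fun n => hf (measurableSet_singleton n)
  refine ⟨fun n => Kernel.piecewise (hs n) m.toKernel 0, fun n => ⟨(n : ℝ≥0∞) + 1, ?_, ?_⟩, ?_⟩
  · exact ENNReal.add_lt_top.2 ⟨ENNReal.natCast_lt_top n, ENNReal.one_lt_top⟩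
  · intro t
    rw [Kernel.piecewise_apply]
    split_ifs with h
    · have := m.isFiniteMeasure t
      have h1 : (m.toKernel t univ).toNNReal < (n : ℝ≥0) + 1 := by
        have h2 : f t = n := h
        rw [← h2]
        exact Nat.lt_floor_add_one _
      rw [← ENNReal.coe_toNNReal (measure_ne_top (m.toKernel t) univ)]
      exact_mod_cast h1.le
    · simp
  · ext t s hs'
    rw [Kernel.sum_apply' _ _ hs', tsum_eq_single (f t)]
    · simp [Kernel.piecewise_apply]
    · intro n hn
      rw [Kernel.piecewise_apply, if_neg]
      · simp
      · exact fun h => hn (Eq.symm h)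

/-- The finite measure `m_t(dx,da) dt` on `[0,T] × closure O × A`. -/
noncomputable def toFiniteMeasure (m : MeasureFlow T O A) :
    FiniteMeasure (Icc (0 : ℝ) T × closure O × A) :=
  ⟨timeMeasure T ⊗ₘ m.toKernel, ⟨by
    rw [Measure.compProd_apply MeasurableSet.univ]
    simpa using m.lintegral_lt_top⟩⟩

end MeasureFlow

/-- The space `V` of flows of positive measures, up to almost everywhere equality in `t`. -/
def FlowSpace (T : ℝ) (O A : Set ℝ) : Type := Quotient (MeasureFlow.setoid T O A)

namespace FlowSpace

variable {T : ℝ} {O A : Set ℝ}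

/-- The finite measure `m_t(dx,da) dt` attached to `m ∈ V`. -/
noncomputable def toFiniteMeasure : FlowSpace T O A → FiniteMeasure (Icc (0 : ℝ) T × closure O × A) :=
  Quotient.lift MeasureFlow.toFiniteMeasure fun m₁ m₂ h =>
    Subtype.ext (Measure.compProd_congr (κ := m₁.toKernel) (η := m₂.toKernel) h)

/-- The topology of `V`: weak convergence of the measures `m_t(dx,da) dt`. -/
noncomputable instance : TopologicalSpace (FlowSpace T O A) :=
  TopologicalSpace.induced toFiniteMeasure inferInstance

/-- The iterated integral `∫_0^T ∫_{closure O × A} F(t,x,a) m_t(dx,da) dt`. -/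
noncomputable def integral (m : FlowSpace T O A) (F : Icc (0 : ℝ) T × closure O × A → ℝ) : ℝ :=
  Quotient.lift (fun m : MeasureFlow T O A => ∫ t, ∫ z, F (t, z) ∂(m.toKernel t) ∂(timeMeasure T))
    (fun m₁ m₂ (h : ∀ᵐ t ∂(timeMeasure T), m₁.toKernel t = m₂.toKernel t) =>
      integral_congr_ae (h.mono fun _ ht => by simp only [ht])) m

end FlowSpace

/-- `v` is continuous and bounded on `[0,T] × closure O` (values elsewhere are irrelevant). -/
def IsCb (T : ℝ) (O : Set ℝ) (v : ℝ → ℝ → ℝ) : Prop :=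
  ContinuousOn (fun p : ℝ × ℝ => v p.1 p.2) (Icc 0 T ×ˢ closure O) ∧
    ∃ C : ℝ, ∀ t ∈ Icc 0 T, ∀ x ∈ closure O, |v t x| ≤ C

/-- `u ∈ C_b^{1,2}([0,T] × closure O)` with `∂_t u = ut`, `∂_x u = ux`, `∂_xx u = uxx`.
Derivatives are taken within `[0,T]` and `closure O` (one-sided at end points); they are unique
when `0 < T` and `O` is open. -/
structure IsC12b (T : ℝ) (O : Set ℝ) (u ut ux uxx : ℝ → ℝ → ℝ) : Prop where
  cb : IsCb T O u
  cb_t : IsCb T O ut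
  cb_x : IsCb T O ux
  cb_xx : IsCb T O uxx
  hasDeriv_t : ∀ t ∈ Icc 0 T, ∀ x ∈ closure O,
    HasDerivWithinAt (fun s => u s x) (ut t x) (Icc 0 T) t
  hasDeriv_x : ∀ t ∈ Icc 0 T, ∀ x ∈ closure O,
    HasDerivWithinAt (fun y => u t y) (ux t x) (closure O) x
  hasDeriv_xx : ∀ t ∈ Icc 0 T, ∀ x ∈ closure O,
    HasDerivWithinAt (fun y => ux t y) (uxx t x) (closure O) x

/-- The class `𝒮` of bounded measurable functions on `[0,T] × closure O × A` that are continuous in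
`(x,a)` for each fixed `t`. -/
structure IsCaratheodory (T : ℝ) (O A : Set ℝ)
    (h : Icc (0 : ℝ) T × closure O × A → ℝ) : Prop where
  measurable : Measurable h
  bounded : ∃ C : ℝ, ∀ p, |h p| ≤ C
  continuous : ∀ t, Continuous fun z : closure O × A => h (t, z)

/-- The standing assumptions on a coefficient `c` (the drift or the volatility): measurable,
bounded, Lipschitz in `x` uniformly in `(t,a)`, and with restriction to `[0,T] × closure O × A` in
the class `𝒮`. -/
structure IsCoefficient (T : ℝ) (O A : Set ℝ) (c : Icc (0 : ℝ) T × ℝ × A → ℝ) : Prop where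
  measurable : Measurable c
  bounded : ∃ C : ℝ, ∀ p, |c p| ≤ C
  lipschitz : ∃ K : ℝ≥0, ∀ (t : Icc (0 : ℝ) T) (a : A), LipschitzWith K fun x => c (t, x, a)
  caratheodory : IsCaratheodory T O A fun p => c (p.1, (p.2.1 : ℝ), p.2.2)

/-- The constraint set `ℛ`: the pairs `(μ, m) ∈ 𝒫([0,T] × closure O) × V` such that, for every test
function `u ∈ C_b^{1,2}([0,T] × closure O)`,
`∫ u dμ = ∫ u(0,x) m₀(dx) + ∫_0^T ∫ (∂_t u + b ∂_x u + (σ²/2) ∂_xx u)(t,x,a) m_t(dx,da) dt`. -/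
def constraintSet (T : ℝ) (O A : Set ℝ) (b : Icc (0 : ℝ) T × ℝ × A → ℝ)
    (σ : Icc (0 : ℝ) T × ℝ × A → ℝ≥0) (m₀ : ProbabilityMeasure O) :
    Set (ProbabilityMeasure (Icc (0 : ℝ) T × closure O) × FlowSpace T O A) :=
  {p | ∀ u ut ux uxx : ℝ → ℝ → ℝ, IsC12b T O u ut ux uxx →
    ∫ z, u z.1 z.2 ∂(p.1 : Measure (Icc (0 : ℝ) T × closure O)) =
      ∫ x, u 0 x ∂(m₀ : Measure O) +
        p.2.integral fun q =>
          ut q.1 q.2.1 + (b (q.1, q.2.1, q.2.2) * ux q.1 q.2.1 +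
            (σ (q.1, q.2.1, q.2.2) : ℝ) ^ 2 / 2 * uxx q.1 q.2.1)}

/-!
The set `ℛ` is compact because it is contained in a product of two weakly compact sets on which the
constraints are closed conditions.

*A priori bounds.* For `(μ, m) ∈ ℛ`, the test function `u(t) = ∫_0^t f` with `f ≥ 0` gives
`∫ f(t) m_t(dx,da) dt ≤ ∫_0^T f(t) dt`, so the time marginal of `ν = m_t(dx,da) dt` is dominated by
Lebesgue measure (`fst_le_timeMeasure`). The functions `g_k(x) = x² / (k² + x²)` have derivatives
of order `1 / k`; testing with `g_k` and `t g_k` bounds `∫ g_k dμ` and `∫ g_k dν` by a multiple of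
`∫ g_k dm₀ + O(1 / k)`, which tends to `0` by dominated convergence (`exists_tail_bound`). Hence
`μ` and `ν` lie in tight sets, compact by Prokhorov's theorem.

*Closedness.* The integrand in the constraint is merely measurable in `t`, so weak convergence of
`ν` does not by itself pass to the limit. As the time marginals are dominated by `dt`, a
Carathéodory integrand `F` may be regarded, on a compact set `K` of the pairs `(x, a)`, as an
element of `L¹(dt; C(K))`, where continuous functions are dense; with tightness this makes
`ν ↦ ∫ F dν` a uniform limit of weakly continuous functions
(`continuousOn_integral_of_caratheodory`).

*Back to flows.* The topology of `V` is induced by `m ↦ m_t(dx,da) dt`, and any finite measure with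
time marginal at most `dt` comes from a flow by disintegration (`exists_toFiniteMeasure_eq`). The
domination passes to weak limits (`isClosed_setOf_fst_le`), so limits stay in the image of `V`.
-/

/-! ### Integrals of Carathéodory functions under weak convergence -/

section StableConvergence

open Filter Topology TopologicalSpace BoundedContinuousFunction

theorem MeasureTheory.Measure.le_of_forall_lintegral_le {α : Type*} [TopologicalSpace α]
    [PseudoMetrizableSpace α] [MeasurableSpace α] [BorelSpace α] {μ ρ : Measure α}
    [IsFiniteMeasure μ] [IsFiniteMeasure ρ]
    (h : ∀ f : α →ᵇ ℝ≥0, ∫⁻ x, f x ∂μ ≤ ∫⁻ x, f x ∂ρ) : μ ≤ ρ := by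
  refine Measure.le_iff.2 fun s hs => ?_
  rw [hs.measure_eq_iSup_isClosed_of_ne_top (measure_ne_top μ s)]
  refine iSup₂_le fun F hFs => iSup_le fun hF => le_trans ?_ (measure_mono hFs)
  exact ge_of_tendsto (HasOuterApproxClosed.tendsto_lintegral_apprSeq hF ρ) <|
    Eventually.of_forall fun n => (HasOuterApproxClosed.measure_le_lintegral hF μ n).trans (h _)

/-- A domination of the first marginals is preserved under weak limits. -/
theorem isClosed_setOf_fst_le {α Z : Type*} [TopologicalSpace α] [PseudoMetrizableSpace α]
    [MeasurableSpace α] [BorelSpace α] [TopologicalSpace Z] [MeasurableSpace Z]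
    [OpensMeasurableSpace (α × Z)] (ρ : Measure α) [IsFiniteMeasure ρ] :
    IsClosed {ν : FiniteMeasure (α × Z) | (ν : Measure (α × Z)).fst ≤ ρ} := by
  have : {ν : FiniteMeasure (α × Z) | (ν : Measure (α × Z)).fst ≤ ρ} =
      ⋂ f : α →ᵇ ℝ≥0, {ν : FiniteMeasure (α × Z) |
        ∫⁻ p, f.compContinuous ⟨Prod.fst, continuous_fst⟩ p ∂(ν : Measure (α × Z)) ≤
          ∫⁻ x, f x ∂ρ} := by
    ext ν
    have key : ∀ f : α →ᵇ ℝ≥0,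
        ∫⁻ p, f.compContinuous ⟨Prod.fst, continuous_fst⟩ p ∂(ν : Measure (α × Z)) =
          ∫⁻ x, f x ∂(ν : Measure (α × Z)).fst := fun f => by
      rw [Measure.fst, lintegral_map (by fun_prop) measurable_fst]
      rfl
    simp only [mem_iInter, mem_ofPred_eq, key]
    exact ⟨fun h f => lintegral_mono' h le_rfl, fun h => Measure.le_of_forall_lintegral_le h⟩
  rw [this]
  exact isClosed_iInter fun f => isClosed_le
    (FiniteMeasure.continuous_lintegral_boundedContinuousFunction _) continuous_const

/-- A map into `C(K, ℝ)` is Borel measurable as soon as its evaluations at points are: closed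
balls are countable intersections of conditions on evaluations, and generate the Borel sets. -/
theorem ContinuousMap.measurable_of_eval {α K : Type*} [MeasurableSpace α] [TopologicalSpace K]
    [CompactSpace K] [SecondCountableTopology K] [MeasurableSpace C(K, ℝ)] [BorelSpace C(K, ℝ)]
    [LocallyCompactSpace K]
    {f : α → C(K, ℝ)} (hf : ∀ z, Measurable fun t => f t z) : Measurable f := by
  obtain ⟨D, hDc, hD⟩ := exists_countable_dense K
  have hball : ∀ (g : C(K, ℝ)) (r : ℝ), 0 ≤ r →
      MeasurableSet (f ⁻¹' Metric.closedBall g r) := by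
    intro g r hr
    have : f ⁻¹' Metric.closedBall g r = ⋂ z ∈ D, {t | dist (f t z) (g z) ≤ r} := by
      ext t
      simp only [mem_preimage, Metric.mem_closedBall, mem_iInter, mem_ofPred_eq,
        ContinuousMap.dist_le hr]
      refine ⟨fun h z _ => h z, fun h z => hD.induction (P := fun z => dist (f t z) (g z) ≤ r) h
        (isClosed_le (by fun_prop) continuous_const) z⟩
    rw [this]
    exact MeasurableSet.biInter hDc fun z _ =>
      measurableSet_le ((hf z).dist measurable_const) measurable_const
  refine measurable_of_isOpen fun U hU => ?_
  choose! r hr hrU using fun g (hg : g ∈ U) =>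
    Metric.nhds_basis_closedBall.mem_iff.1 (hU.mem_nhds hg)
  obtain ⟨S, hSU, hS, hSeq⟩ := isOpen_biUnion_countable U (fun g => Metric.ball g (r g))
    fun g _ => Metric.isOpen_ball
  have : f ⁻¹' U = ⋃ g ∈ S, f ⁻¹' Metric.closedBall g (r g) := by
    rw [← preimage_iUnion₂]
    congr 1
    refine subset_antisymm (fun g hg => ?_) (iUnion₂_subset fun g hg => hrU g (hSU hg))
    have : g ∈ ⋃ g ∈ U, Metric.ball g (r g) := mem_biUnion hg (Metric.mem_ball_self (hr g hg))
    rw [← hSeq] at this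
    exact biUnion_mono subset_rfl (fun g _ => Metric.ball_subset_closedBall) this
  rw [this]
  exact MeasurableSet.biUnion hS fun g hg => hball g _ (hr g (hSU hg)).le

/-- On a compact set of the second variable, a bounded Carathéodory function is approximated by a
bounded continuous function, in the `L¹` norm in the first variable and uniformly in the second
one. -/
theorem exists_boundedContinuous_approx_of_caratheodory {α Z : Type*} [TopologicalSpace α]
    [CompactSpace α] [MetrizableSpace α] [MeasurableSpace α] [BorelSpace α] [TopologicalSpace Z]
    [MetrizableSpace Z] [SecondCountableTopology Z] [MeasurableSpace Z] [BorelSpace Z]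
    (ρ : Measure α) [IsFiniteMeasure ρ] {K : Set Z} (hK : IsCompact K) {F : α × Z → ℝ}
    (hF : Measurable F) {C : ℝ} (hC : ∀ p, |F p| ≤ C) (hFc : ∀ t, Continuous fun z => F (t, z))
    {ε : ℝ≥0∞} (hε : ε ≠ 0) :
    ∃ (G : α × Z →ᵇ ℝ) (e : α → ℝ≥0∞), (∀ p, |G p| ≤ C) ∧ Measurable e ∧ ∫⁻ t, e t ∂ρ ≤ ε ∧
      ∀ t, ∀ z ∈ K, ‖F (t, z) - G (t, z)‖ₑ ≤ e t := by
  rcases isEmpty_or_nonempty (α × Z) with hemp | ⟨⟨p₀⟩⟩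
  · exact ⟨0, 0, fun p => hemp.elim p, measurable_const, by simp,
      fun t z _ => hemp.elim (t, z)⟩
  have hC0 : 0 ≤ C := (abs_nonneg _).trans (hC p₀)
  have : CompactSpace K := isCompact_iff_compactSpace.1 hK
  borelize C(K, ℝ)
  let f : α → C(K, ℝ) := fun t => ⟨fun z => F (t, z), (hFc t).comp continuous_subtype_val⟩
  have hf : Measurable f := ContinuousMap.measurable_of_eval fun z =>
    hF.comp measurable_prodMk_right
  have hfint : Integrable f ρ := Integrable.of_bound hf.aestronglyMeasurable C <|
    Eventually.of_forall fun t => (ContinuousMap.norm_le _ hC0).2 fun z => hC _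
  obtain ⟨g, hg, -⟩ := hfint.exists_boundedContinuous_lintegral_sub_le hε
  let g' : C(α × K, ℝ) := ⟨fun p => g p.1 p.2, by fun_prop⟩
  have hemb : IsClosedEmbedding (Prod.map id Subtype.val : α × K → α × Z) :=
    IsClosedEmbedding.id.prodMap hK.isClosed.isClosedEmbedding_subtypeVal
  obtain ⟨G, -, hG⟩ :=
    exists_extension_norm_eq_of_isClosedEmbedding (BoundedContinuousFunction.mkOfCompact g') hemb
  -- clipping to `[-C, C]` makes the bound uniform and does not increase the distance to `F`
  let G' : α × Z →ᵇ ℝ := BoundedContinuousFunction.ofNormedAddCommGroup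
    (fun p => max (-C) (min C (G p))) (by fun_prop) C fun p =>
      abs_le.2 ⟨le_max_left _ _, max_le (by linarith) (min_le_left _ _)⟩
  refine ⟨G', fun t => ‖f t - g t‖ₑ, fun p => ?_, ?_, hg, fun t z hz => ?_⟩
  · exact abs_le.2 ⟨le_max_left _ _, max_le (by linarith) (min_le_left _ _)⟩
  · exact (hf.sub g.continuous.measurable).enorm
  · rw [enorm_le_iff_norm_le]
    refine le_trans ?_ ((f t - g t).norm_coe_le_norm ⟨z, hz⟩)
    have h1 : G (t, z) = g t ⟨z, hz⟩ := congrFun hG (t, ⟨z, hz⟩)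
    have h2 := abs_le.1 (hC (t, z))
    change |F (t, z) - max (-C) (min C (G (t, z)))| ≤ |F (t, z) - g t ⟨z, hz⟩|
    rw [h1]
    have h3 : F (t, z) = max (-C) (min C (F (t, z))) := by
      rw [min_eq_right h2.2, max_eq_right h2.1]
    calc |F (t, z) - max (-C) (min C (g t ⟨z, hz⟩))|
        = |max (-C) (min C (F (t, z))) - max (-C) (min C (g t ⟨z, hz⟩))| := by rw [← h3]
      _ ≤ |min C (F (t, z)) - min C (g t ⟨z, hz⟩)| := by
          rw [max_comm (-C), max_comm (-C)]
          exact abs_max_sub_max_le_abs _ _ _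
      _ ≤ |F (t, z) - g t ⟨z, hz⟩| := abs_min_sub_min_le_max _ _ _ _ |>.trans (by simp)

/-- Integration of a bounded Carathéodory function is weakly continuous on a set of measures which
is uniformly tight in the second variable and whose first marginals are dominated by a fixed
measure. -/
theorem continuousOn_integral_of_caratheodory {α Z : Type*} [TopologicalSpace α]
    [CompactSpace α] [MetrizableSpace α] [MeasurableSpace α] [BorelSpace α] [TopologicalSpace Z]
    [MetrizableSpace Z] [SecondCountableTopology Z] [MeasurableSpace Z] [BorelSpace Z]
    (ρ : Measure α) [IsFiniteMeasure ρ] {K : ℕ → Set Z} (hK : ∀ n, IsCompact (K n))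
    {u : ℕ → ℝ≥0} (hu : Tendsto u atTop (𝓝 0)) {F : α × Z → ℝ} (hF : Measurable F)
    {C : ℝ} (hC : ∀ p, |F p| ≤ C) (hFc : ∀ t, Continuous fun z => F (t, z)) :
    ContinuousOn (fun ν : FiniteMeasure (α × Z) => ∫ p, F p ∂(ν : Measure (α × Z)))
      {ν | (ν : Measure (α × Z)).fst ≤ ρ ∧ ∀ n, ν (univ ×ˢ K n)ᶜ ≤ u n} := by
  refine continuousOn_of_uniform_approx_of_continuousOn fun U hU => ?_
  obtain ⟨ε, hε, hεU⟩ := Metric.mem_uniformity_dist.1 hU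
  -- `2 |C|` bounds `|F - G|` off the compact set, which has mass at most `u n`
  obtain ⟨n, hn⟩ : ∃ n, 2 * |C| * (u n : ℝ) < ε / 2 := by
    have : Tendsto (fun n => 2 * |C| * (u n : ℝ)) atTop (𝓝 (2 * |C| * ((0 : ℝ≥0) : ℝ))) :=
      (NNReal.tendsto_coe.2 hu).const_mul _
    exact (this.eventually (gt_mem_nhds (by simpa using half_pos hε))).exists
  obtain ⟨G, e, hGC, he, heε, hFG⟩ := exists_boundedContinuous_approx_of_caratheodory ρ (hK n) hF
    hC hFc (ε := ENNReal.ofReal (ε / 2)) (by simpa using hε)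
  refine ⟨fun ν => ∫ p, G p ∂(ν : Measure (α × Z)),
    (FiniteMeasure.continuous_integral_boundedContinuousFunction G).continuousOn, ?_⟩
  rintro ν ⟨hν, hνK⟩
  apply hεU
  have hFi : Integrable F (ν : Measure (α × Z)) :=
    Integrable.of_bound hF.aestronglyMeasurable C (Eventually.of_forall hC)
  have hGi : Integrable G (ν : Measure (α × Z)) := G.integrable _
  have hKm : MeasurableSet ((univ : Set α) ×ˢ K n)ᶜ :=
    (MeasurableSet.univ.prod (hK n).measurableSet).compl
  have he' : Measurable fun p : α × Z => e p.1 := he.comp measurable_fst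
  rw [dist_eq_norm, ← integral_sub hFi hGi]
  have key : ‖∫ p, (F p - G p) ∂(ν : Measure (α × Z))‖ₑ ≤
      ENNReal.ofReal (ε / 2) + ENNReal.ofReal (2 * |C|) * u n := by
    calc ‖∫ p, (F p - G p) ∂(ν : Measure (α × Z))‖ₑ
        ≤ ∫⁻ p, ‖F p - G p‖ₑ ∂(ν : Measure (α × Z)) := enorm_integral_le_lintegral_enorm _
      _ ≤ ∫⁻ p, (e p.1 + ((univ : Set α) ×ˢ K n)ᶜ.indicator
            (fun _ => ENNReal.ofReal (2 * |C|)) p) ∂(ν : Measure (α × Z)) := by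
          refine lintegral_mono fun p => ?_
          by_cases hp : p.2 ∈ K n
          · exact (hFG p.1 p.2 hp).trans le_self_add
          · rw [indicator_of_mem (by simpa using hp)]
            refine le_add_left ?_
            rw [← ofReal_norm]
            refine ENNReal.ofReal_le_ofReal ?_
            have := norm_sub_le (F p) (G p)
            simp only [Real.norm_eq_abs] at this ⊢
            linarith [hC p, hGC p, le_abs_self C]
      _ = ∫⁻ t, e t ∂(ν : Measure (α × Z)).fst +
            ENNReal.ofReal (2 * |C|) * (ν : Measure (α × Z)) (univ ×ˢ K n)ᶜ := by
          rw [lintegral_add_left he', lintegral_indicator_const hKm,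
            Measure.fst, lintegral_map he measurable_fst]
      _ ≤ _ := by
          gcongr
          · exact (lintegral_mono' hν le_rfl).trans heε
          · rw [← FiniteMeasure.ennreal_coeFn_eq_coeFn_toMeasure]
            exact_mod_cast hνK n
  have h2 : ENNReal.ofReal (ε / 2) + ENNReal.ofReal (2 * |C|) * u n =
      ENNReal.ofReal (ε / 2 + 2 * |C| * u n) := by
    rw [ENNReal.ofReal_add (by positivity) (by positivity),
      ENNReal.ofReal_mul (p := 2 * |C|) (by positivity), ENNReal.ofReal_coe_nnreal]
  rw [h2, ← ofReal_norm, ENNReal.ofReal_le_ofReal_iff (by positivity)] at key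
  linarith

end StableConvergence

/-! ### Flows of measures as finite measures -/

section FlowSpace

variable {T : ℝ} {O A : Set ℝ}

theorem timeMeasure_univ (T : ℝ) : timeMeasure T univ = ENNReal.ofReal T := by
  rw [timeMeasure, comap_subtype_coe_apply measurableSet_Icc, image_univ, Subtype.range_coe,
    Real.volume_Icc, sub_zero]

/-- A finite measure whose time marginal is dominated by `dt` disintegrates along a flow: its
conditional kernel is multiplied by the density of the time marginal. -/
theorem exists_toFiniteMeasure_eq (hA : IsClosed A)
    (ν : FiniteMeasure (Icc (0 : ℝ) T × closure O × A))
    (hν : (ν : Measure (Icc (0 : ℝ) T × closure O × A)).fst ≤ timeMeasure T) :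
    ∃ m : FlowSpace T O A, m.toFiniteMeasure = ν := by
  have : StandardBorelSpace A := hA.measurableSet.standardBorel
  have : StandardBorelSpace (closure O) := isClosed_closure.measurableSet.standardBorel
  let ν' : Measure (Icc (0 : ℝ) T × closure O × A) := ν
  rcases isEmpty_or_nonempty (closure O × A) with hemp | hne
  · let m : MeasureFlow T O A := ⟨0, fun t => by rw [zero_apply]; infer_instance, by simp⟩
    refine ⟨Quotient.mk _ m, Subtype.ext (Measure.ext fun s _ => ?_)⟩
    rw [Set.eq_empty_of_isEmpty s, measure_empty, measure_empty]
  let f : Icc (0 : ℝ) T → ℝ≥0 := fun t => (ν'.fst.rnDeriv (timeMeasure T) t).toNNReal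
  have hf : Measurable f := (Measure.measurable_rnDeriv _ _).ennreal_toNNReal
  have hfe : (timeMeasure T).withDensity (fun t => (f t : ℝ≥0∞)) = ν'.fst := by
    rw [← Measure.withDensity_rnDeriv_eq ν'.fst (timeMeasure T)
      (Measure.absolutelyContinuous_of_le hν)]
    refine withDensity_congr_ae ?_
    filter_upwards [Measure.rnDeriv_lt_top ν'.fst (timeMeasure T)] with t ht
    exact ENNReal.coe_toNNReal ht.ne
  have hf' : Measurable fun t => (f t : ℝ≥0∞) := hf.coe_nnreal_ennreal
  let κ : Kernel (Icc (0 : ℝ) T) (closure O × A) :=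
    ⟨fun t => (f t : ℝ≥0∞) • ν'.condKernel t, by
      refine Measure.measurable_of_measurable_coe _ fun s hs => ?_
      simp only [Measure.smul_apply, smul_eq_mul]
      exact hf'.mul (ν'.condKernel.measurable_coe hs)⟩
  obtain ⟨m, hm⟩ : ∃ m : MeasureFlow T O A,
      ∀ t, m.toKernel t = (f t : ℝ≥0∞) • ν'.condKernel t := by
    refine ⟨⟨κ, fun t => ?_, ?_⟩, fun t => rfl⟩
    · change IsFiniteMeasure ((f t : ℝ≥0∞) • ν'.condKernel t)
      exact ⟨by simp⟩
    · change ∫⁻ t, ((f t : ℝ≥0∞) • ν'.condKernel t) univ ∂(timeMeasure T) < ∞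
      simp only [Measure.smul_apply, measure_univ, smul_eq_mul, mul_one]
      rw [← setLIntegral_univ, ← withDensity_apply _ MeasurableSet.univ, hfe]
      exact measure_lt_top _ _
  refine ⟨Quotient.mk _ m, Subtype.ext (Measure.ext fun s hs => ?_)⟩
  change (timeMeasure T ⊗ₘ m.toKernel) s = ν' s
  conv_rhs => rw [← ν'.disintegrate ν'.condKernel]
  rw [Measure.compProd_apply hs, Measure.compProd_apply hs, ← hfe,
    lintegral_withDensity_eq_lintegral_mul _ hf' (Kernel.measurable_kernel_prodMk_left hs)]
  simp only [hm, Measure.smul_apply, smul_eq_mul, Pi.mul_apply]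

/-- Fubini: the iterated integral agrees with the one against the measure `m_t(dx,da) dt`. -/
theorem FlowSpace.integral_eq {F : Icc (0 : ℝ) T × closure O × A → ℝ}
    (hF : IsCaratheodory T O A F) (m : FlowSpace T O A) :
    m.integral F = ∫ p, F p ∂(m.toFiniteMeasure : Measure (Icc (0 : ℝ) T × closure O × A)) := by
  induction m using Quotient.inductionOn with | _ m
  obtain ⟨C, hC⟩ := hF.bounded
  have : IsFiniteMeasure (timeMeasure T ⊗ₘ m.toKernel) := m.toFiniteMeasure.2
  exact (Measure.integral_compProd (μ := timeMeasure T) (κ := m.toKernel) (f := F) <|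
    Integrable.of_bound hF.measurable.aestronglyMeasurable C (Filter.Eventually.of_forall hC)).symm

end FlowSpace

/-! ### The integrand of the constraint -/

section TestFunctions

variable {T : ℝ} {O A : Set ℝ}

/-- The function `∂_t u + b ∂_x u + (σ²/2) ∂_xx u`. -/
noncomputable abbrev generatorFun (b : Icc (0 : ℝ) T × ℝ × A → ℝ)
    (σ : Icc (0 : ℝ) T × ℝ × A → ℝ≥0) (ut ux uxx : ℝ → ℝ → ℝ) :
    Icc (0 : ℝ) T × closure O × A → ℝ := fun q =>
  ut q.1 q.2.1 + (b (q.1, q.2.1, q.2.2) * ux q.1 q.2.1 +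
    (σ (q.1, q.2.1, q.2.2) : ℝ) ^ 2 / 2 * uxx q.1 q.2.1)

namespace IsCb

variable {v : ℝ → ℝ → ℝ}

theorem continuous_subtype (h : IsCb T O v) :
    Continuous fun p : Icc (0 : ℝ) T × closure O => v p.1 p.2 :=
  h.1.comp_continuous (f := fun p : Icc (0 : ℝ) T × closure O => ((p.1 : ℝ), (p.2 : ℝ)))
    (by fun_prop) fun p => ⟨p.1.2, p.2.2⟩

theorem isCaratheodory (h : IsCb T O v) :
    IsCaratheodory T O A fun q => v q.1 q.2.1 := by
  have hc : Continuous fun q : Icc (0 : ℝ) T × closure O × A => v q.1 q.2.1 :=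
    h.continuous_subtype.comp (f := fun q : Icc (0 : ℝ) T × closure O × A => (q.1, q.2.1))
      (by fun_prop)
  obtain ⟨C, hC⟩ := h.2
  exact ⟨hc.measurable, ⟨C, fun q => hC _ q.1.2 _ q.2.1.2⟩, fun t => hc.comp (by fun_prop)⟩

end IsCb

namespace IsCaratheodory

variable {g h : Icc (0 : ℝ) T × closure O × A → ℝ}

theorem add (hg : IsCaratheodory T O A g) (hh : IsCaratheodory T O A h) :
    IsCaratheodory T O A fun q => g q + h q := by
  obtain ⟨C, hC⟩ := hg.bounded
  obtain ⟨D, hD⟩ := hh.bounded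
  exact ⟨hg.measurable.add hh.measurable,
    ⟨C + D, fun q => (abs_add_le _ _).trans (add_le_add (hC q) (hD q))⟩,
    fun t => (hg.continuous t).add (hh.continuous t)⟩

theorem mul (hg : IsCaratheodory T O A g) (hh : IsCaratheodory T O A h) :
    IsCaratheodory T O A fun q => g q * h q := by
  obtain ⟨C, hC⟩ := hg.bounded
  obtain ⟨D, hD⟩ := hh.bounded
  refine ⟨hg.measurable.mul hh.measurable, ⟨C * D, fun q => ?_⟩,
    fun t => (hg.continuous t).mul (hh.continuous t)⟩
  rw [abs_mul]
  exact mul_le_mul (hC q) (hD q) (abs_nonneg _) ((abs_nonneg _).trans (hC q))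

end IsCaratheodory

theorem isCaratheodory_generatorFun {b : Icc (0 : ℝ) T × ℝ × A → ℝ}
    {σ : Icc (0 : ℝ) T × ℝ × A → ℝ≥0} (hb : IsCoefficient T O A b)
    (hσ : IsCoefficient T O A fun p => (σ p : ℝ)) {u ut ux uxx : ℝ → ℝ → ℝ}
    (hu : IsC12b T O u ut ux uxx) :
    IsCaratheodory T O A (generatorFun (O := O) b σ ut ux uxx) := by
  have h := hu.cb_t.isCaratheodory.add ((hb.caratheodory.mul hu.cb_x.isCaratheodory).add
    ((hσ.caratheodory.mul hσ.caratheodory).mul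
      ((show IsCb T O fun t x => 2⁻¹ * uxx t x from
        ⟨continuousOn_const.mul hu.cb_xx.1, by
          obtain ⟨C, hC⟩ := hu.cb_xx.2
          refine ⟨C, fun t ht x hx => ?_⟩
          have := hC t ht x hx
          rw [abs_mul, abs_of_pos (by norm_num)]
          linarith [abs_nonneg (uxx t x)]⟩).isCaratheodory (A := A))))
  convert h using 2
  ring

end TestFunctions

/-! ### A priori estimates from test functions -/

section Estimates

open Filter Topology BoundedContinuousFunction

variable {T : ℝ} {O A : Set ℝ}

theorem isC12b_mul {φ φ' g g' g'' : ℝ → ℝ} (hφ : ∀ t, HasDerivAt φ (φ' t) t)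
    (hφ' : Continuous φ') (hg : ∀ x, HasDerivAt g (g' x) x) (hg' : ∀ x, HasDerivAt g' (g'' x) x)
    (hg'' : Continuous g'') {C : ℝ} (hC : ∀ x, |g x| ≤ C) (hC' : ∀ x, |g' x| ≤ C)
    (hC'' : ∀ x, |g'' x| ≤ C) :
    IsC12b T O (fun t x => φ t * g x) (fun t x => φ' t * g x) (fun t x => φ t * g' x)
      (fun t x => φ t * g'' x) := by
  have hφc : Continuous φ := continuous_iff_continuousAt.2 fun t => (hφ t).continuousAt
  have hgc : Continuous g := continuous_iff_continuousAt.2 fun t => (hg t).continuousAt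
  have hgc' : Continuous g' := continuous_iff_continuousAt.2 fun t => (hg' t).continuousAt
  have key : ∀ ψ h : ℝ → ℝ, Continuous ψ → Continuous h → (∀ x, |h x| ≤ C) →
      IsCb T O fun t x => ψ t * h x := by
    intro ψ h hψ hh hhC
    obtain ⟨D, hD⟩ := (isCompact_Icc (a := (0 : ℝ)) (b := T)).exists_bound_of_continuousOn
      hψ.continuousOn
    refine ⟨Continuous.continuousOn (by fun_prop), D * C, fun t ht x _ => ?_⟩
    rw [abs_mul]
    exact mul_le_mul (hD t ht) (hhC x) (abs_nonneg _) ((norm_nonneg _).trans (hD t ht))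
  exact ⟨key _ _ hφc hgc hC, key _ _ hφ' hgc hC, key _ _ hφc hgc' hC', key _ _ hφc hg'' hC'',
    fun t _ x _ => ((hφ t).mul_const _).hasDerivWithinAt,
    fun t _ x _ => ((hg x).const_mul _).hasDerivWithinAt,
    fun t _ x _ => ((hg' x).const_mul _).hasDerivWithinAt⟩

/-- A smooth function with values in `[0, 1]` that is at least `1 / 2` where `k ≤ |x|`, tends to
`0` pointwise as `k → ∞`, and whose derivatives are of order `1 / k`. -/
noncomputable def tailFun (k x : ℝ) : ℝ := x ^ 2 / (k ^ 2 + x ^ 2)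

/-- The derivative of `tailFun`. -/
noncomputable def tailDeriv (k x : ℝ) : ℝ := 2 * k ^ 2 * x / (k ^ 2 + x ^ 2) ^ 2

/-- The second derivative of `tailFun`. -/
noncomputable def tailDeriv2 (k x : ℝ) : ℝ := 2 * k ^ 2 * (k ^ 2 - 3 * x ^ 2) / (k ^ 2 + x ^ 2) ^ 3

section tailFun

variable {k : ℝ}

theorem tailFun_nonneg (k x : ℝ) : 0 ≤ tailFun k x := by unfold tailFun; positivity

theorem abs_tailFun_le (k x : ℝ) : |tailFun k x| ≤ 1 := by
  rw [abs_of_nonneg (tailFun_nonneg k x)]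
  exact div_le_one_of_le₀ (by nlinarith [sq_nonneg k]) (by positivity)

theorem half_le_tailFun (hk : 0 < k) {x : ℝ} (hx : k ≤ |x|) : 1 / 2 ≤ tailFun k x := by
  have : k ^ 2 ≤ x ^ 2 := by
    rw [← sq_abs x]
    gcongr
  rw [tailFun, div_le_div_iff₀ (by norm_num) (by positivity)]
  linarith

theorem abs_tailDeriv_le (hk : 0 < k) (x : ℝ) : |tailDeriv k x| ≤ 1 / k := by
  have h1 : 2 * k * |x| ≤ k ^ 2 + x ^ 2 := by nlinarith [sq_nonneg (k - |x|), sq_abs x]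
  rw [tailDeriv, abs_div, abs_mul, abs_of_nonneg (show 0 ≤ 2 * k ^ 2 by positivity),
    abs_of_nonneg (show 0 ≤ (k ^ 2 + x ^ 2) ^ 2 by positivity),
    div_le_div_iff₀ (by positivity) hk]
  have h2 : k ^ 2 ≤ k ^ 2 + x ^ 2 := by nlinarith [sq_nonneg x]
  nlinarith [mul_le_mul h1 h2 (by positivity) (by positivity)]

theorem abs_tailDeriv2_le (hk : 1 ≤ k) (x : ℝ) : |tailDeriv2 k x| ≤ 6 / k := by
  have h1 : |k ^ 2 - 3 * x ^ 2| ≤ 3 * (k ^ 2 + x ^ 2) :=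
    abs_le.2 ⟨by nlinarith [sq_nonneg x, sq_nonneg k], by nlinarith [sq_nonneg x, sq_nonneg k]⟩
  have h2 : k ≤ k ^ 2 + x ^ 2 := by nlinarith [sq_nonneg x]
  have h3 : k ^ 2 ≤ k ^ 2 + x ^ 2 := by nlinarith [sq_nonneg x]
  have hk0 : 0 < k := by linarith
  rw [tailDeriv2, abs_div, abs_mul, abs_of_nonneg (show 0 ≤ 2 * k ^ 2 by positivity),
    abs_of_nonneg (show 0 ≤ (k ^ 2 + x ^ 2) ^ 3 by positivity),
    div_le_div_iff₀ (by positivity) hk0]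
  calc 2 * k ^ 2 * |k ^ 2 - 3 * x ^ 2| * k
      ≤ 2 * (k ^ 2 + x ^ 2) * (3 * (k ^ 2 + x ^ 2)) * (k ^ 2 + x ^ 2) := by gcongr
    _ = 6 * (k ^ 2 + x ^ 2) ^ 3 := by ring

theorem hasDerivAt_tailFun (hk : 0 < k) (x : ℝ) : HasDerivAt (tailFun k) (tailDeriv k x) x := by
  have h : k ^ 2 + x ^ 2 ≠ 0 := by positivity
  refine ((hasDerivAt_pow 2 x).div ((hasDerivAt_pow 2 x).const_add (k ^ 2)) h).congr_deriv ?_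
  rw [tailDeriv]
  congr 1
  push_cast
  ring

theorem hasDerivAt_tailDeriv (hk : 0 < k) (x : ℝ) :
    HasDerivAt (tailDeriv k) (tailDeriv2 k x) x := by
  have h : k ^ 2 + x ^ 2 ≠ 0 := by positivity
  refine (((hasDerivAt_id x).const_mul (2 * k ^ 2)).div
    (((hasDerivAt_pow 2 x).const_add (k ^ 2)).pow 2) (pow_ne_zero 2 h)).congr_deriv ?_
  rw [tailDeriv2]
  simp only [Pi.pow_apply, id]
  field_simp
  push_cast
  ring

theorem continuous_tailFun (hk : 0 < k) : Continuous (tailFun k) :=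
  continuous_iff_continuousAt.2 fun x => (hasDerivAt_tailFun hk x).continuousAt

theorem continuous_tailDeriv2 (hk : 0 < k) : Continuous (tailDeriv2 k) := by
  unfold tailDeriv2
  exact Continuous.div (by fun_prop) (by fun_prop) fun x => by positivity

theorem tendsto_integral_tailFun {S : Set ℝ} (m : Measure S) [IsFiniteMeasure m] :
    Tendsto (fun n : ℕ => ∫ x : S, tailFun (n + 1) x ∂m) atTop (𝓝 0) := by
  have hpos : ∀ n : ℕ, (0 : ℝ) < n + 1 := fun n => by positivity
  have h : Tendsto (fun n : ℕ => ∫ x : S, tailFun (n + 1) x ∂m) atTop (𝓝 (∫ _ : S, (0 : ℝ) ∂m)) := by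
    refine tendsto_integral_of_dominated_convergence (fun _ => 1) (fun n => ?_)
      (integrable_const _) (fun n => Eventually.of_forall fun x => abs_tailFun_le _ _)
      (Eventually.of_forall fun x => ?_)
    · exact ((continuous_tailFun (hpos n)).comp continuous_subtype_val).aestronglyMeasurable
    · refine squeeze_zero (fun n => tailFun_nonneg _ _) (fun n => ?_)
        (g := fun n : ℕ => (x : ℝ) ^ 2 * (1 / ((n : ℝ) + 1)))
        (by simpa using (tendsto_one_div_add_atTop_nhds_zero_nat (𝕜 := ℝ)).const_mul ((x : ℝ) ^ 2))
      rw [tailFun, mul_one_div]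
      refine div_le_div_of_nonneg_left (sq_nonneg _) (hpos n) ?_
      nlinarith [sq_nonneg (x : ℝ), n.cast_nonneg (α := ℝ)]
  simpa using h

end tailFun

/-- The constraint for one test function, as an identity between integrals against the finite
measure `m_t(dx,da) dt`. -/
def SatisfiesConstraint (b : Icc (0 : ℝ) T × ℝ × A → ℝ)
    (σ : Icc (0 : ℝ) T × ℝ × A → ℝ≥0) (m₀ : ProbabilityMeasure O)
    (μ : ProbabilityMeasure (Icc (0 : ℝ) T × closure O))
    (ν : FiniteMeasure (Icc (0 : ℝ) T × closure O × A)) (u ut ux uxx : ℝ → ℝ → ℝ) : Prop :=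
  ∫ z, u z.1 z.2 ∂(μ : Measure (Icc (0 : ℝ) T × closure O)) =
    ∫ x, u 0 x ∂(m₀ : Measure O) +
      ∫ q, generatorFun b σ ut ux uxx q ∂(ν : Measure (Icc (0 : ℝ) T × closure O × A))

theorem mem_constraintSet_iff {b : Icc (0 : ℝ) T × ℝ × A → ℝ} {σ : Icc (0 : ℝ) T × ℝ × A → ℝ≥0}
    (hb : IsCoefficient T O A b) (hσ : IsCoefficient T O A fun p => (σ p : ℝ))
    {m₀ : ProbabilityMeasure O} {μ : ProbabilityMeasure (Icc (0 : ℝ) T × closure O)}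
    {m : FlowSpace T O A} :
    (μ, m) ∈ constraintSet T O A b σ m₀ ↔ ∀ u ut ux uxx : ℝ → ℝ → ℝ, IsC12b T O u ut ux uxx →
      SatisfiesConstraint b σ m₀ μ m.toFiniteMeasure u ut ux uxx := by
  refine forall₄_congr fun u ut ux uxx => forall_congr' fun hu => ?_
  rw [SatisfiesConstraint, ← FlowSpace.integral_eq (isCaratheodory_generatorFun hb hσ hu)]

variable {b : Icc (0 : ℝ) T × ℝ × A → ℝ} {σ : Icc (0 : ℝ) T × ℝ × A → ℝ≥0}
  {m₀ : ProbabilityMeasure O} {μ : ProbabilityMeasure (Icc (0 : ℝ) T × closure O)}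
  {ν : FiniteMeasure (Icc (0 : ℝ) T × closure O × A)}

/-- Testing with `u(t) = ∫_0^t f` shows that the time marginal of `m_t(dx,da) dt` is at most
`dt`. -/
theorem fst_le_timeMeasure (hT : 0 < T)
    (h : ∀ u ut ux uxx : ℝ → ℝ → ℝ, IsC12b T O u ut ux uxx →
      SatisfiesConstraint b σ m₀ μ ν u ut ux uxx) :
    (ν : Measure (Icc (0 : ℝ) T × closure O × A)).fst ≤ timeMeasure T := by
  refine Measure.le_of_forall_lintegral_le fun f => ?_
  let F : ℝ → ℝ := fun t => f (projIcc 0 T hT.le t)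
  have hFc : Continuous F :=
    NNReal.continuous_coe.comp (f.continuous.comp continuous_projIcc)
  have hF0 : ∀ t, 0 ≤ F t := fun t => NNReal.coe_nonneg _
  have hFval : ∀ t : Icc (0 : ℝ) T, F t = f t := fun t => by simp [F]
  have hint : ∀ a b : ℝ, IntervalIntegrable F volume a b := fun a b => hFc.intervalIntegrable a b
  have key := h _ _ _ _ (isC12b_mul (φ := fun t => ∫ s in (0 : ℝ)..t, F s) (φ' := F)
    (g := fun _ => 1) (g' := fun _ => 0) (g'' := fun _ => 0) (C := 1)
    (fun t => intervalIntegral.integral_hasDerivAt_right (hint 0 t)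
      hFc.aestronglyMeasurable.stronglyMeasurableAtFilter hFc.continuousAt)
    hFc (fun x => hasDerivAt_const x 1) (fun x => hasDerivAt_const x 0) continuous_const
    (by simp) (by simp) (by simp))
  simp only [SatisfiesConstraint, generatorFun, mul_one, intervalIntegral.integral_same,
    integral_zero, mul_zero, add_zero, zero_add, hFval] at key
  have hfb : ∀ t, ‖(f t : ℝ)‖ ≤ dist f 0 := fun t => by
    simpa [NNReal.dist_eq] using f.dist_coe_le_dist (g := 0) t
  have hfm : Measurable fun t => (f t : ℝ) := (NNReal.continuous_coe.comp f.continuous).measurable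
  have hle : ∫ q, (f q.1 : ℝ) ∂(ν : Measure (Icc (0 : ℝ) T × closure O × A)) ≤
      ∫ t, (f t : ℝ) ∂timeMeasure T := by
    have hconst : ∫ t, (f t : ℝ) ∂timeMeasure T = ∫ s in (0 : ℝ)..T, F s := by
      rw [intervalIntegral.integral_of_le hT.le, ← integral_Icc_eq_integral_Ioc,
        ← integral_subtype_comap measurableSet_Icc]
      simp only [hFval]
      rfl
    rw [← key, hconst]
    have hle' : ∀ z : Icc (0 : ℝ) T × closure O,
        ∫ s in (0 : ℝ)..z.1, F s ≤ ∫ s in (0 : ℝ)..T, F s := fun z =>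
      intervalIntegral.integral_mono_interval le_rfl z.1.2.1 z.1.2.2
        (Eventually.of_forall hF0) (hint 0 T)
    have hm : Continuous fun z : Icc (0 : ℝ) T × closure O => ∫ s in (0 : ℝ)..z.1, F s :=
      (intervalIntegral.continuous_primitive hint 0).comp (by fun_prop)
    calc ∫ z : Icc (0 : ℝ) T × closure O, (∫ s in (0 : ℝ)..z.1, F s) ∂(μ : Measure _)
        ≤ ∫ _ : Icc (0 : ℝ) T × closure O, (∫ s in (0 : ℝ)..T, F s) ∂(μ : Measure _) := by
          refine integral_mono (Integrable.of_bound hm.aestronglyMeasurable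
            (∫ s in (0 : ℝ)..T, F s) (Eventually.of_forall fun z => ?_)) (integrable_const _) hle'
          rw [Real.norm_of_nonneg (intervalIntegral.integral_nonneg z.1.2.1 fun s _ => hF0 s)]
          exact hle' z
      _ = _ := by simp
  have h1 : Integrable (fun q : Icc (0 : ℝ) T × closure O × A => (f q.1 : ℝ)) (ν : Measure _) :=
    Integrable.of_bound (hfm.comp measurable_fst).aestronglyMeasurable _
      (Eventually.of_forall fun q => hfb q.1)
  have h2 : Integrable (fun t => (f t : ℝ)) (timeMeasure T) :=
    Integrable.of_bound hfm.aestronglyMeasurable _ (Eventually.of_forall hfb)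
  have h3 := ENNReal.ofReal_le_ofReal hle
  rw [ofReal_integral_eq_lintegral_ofReal h1 (Eventually.of_forall fun _ => NNReal.coe_nonneg _),
    ofReal_integral_eq_lintegral_ofReal h2 (Eventually.of_forall fun _ => NNReal.coe_nonneg _)] at h3
  simp only [ENNReal.ofReal_coe_nnreal] at h3
  rwa [Measure.fst, lintegral_map f.continuous.measurable.coe_nnreal_ennreal measurable_fst]

theorem mass_le_of_fst_le
    (h : (ν : Measure (Icc (0 : ℝ) T × closure O × A)).fst ≤ timeMeasure T) :
    ν.mass ≤ T.toNNReal := by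
  have := h univ
  rw [Measure.fst_univ, timeMeasure_univ, ← FiniteMeasure.ennreal_mass] at this
  exact ENNReal.coe_le_coe.1 this

theorem measureReal_le_two_mul_integral {X : Type*} [MeasurableSpace X] {P : Measure X}
    [IsFiniteMeasure P] {g : X → ℝ} {S : Set X} (hg : Integrable g P) (hg0 : ∀ x, 0 ≤ g x)
    (hS : ∀ x ∈ S, 1 / 2 ≤ g x) : P.real S ≤ 2 * ∫ x, g x ∂P := by
  have h1 := mul_meas_ge_le_integral_of_nonneg (Eventually.of_forall hg0) hg (1 / 2)
  have h2 : P.real S ≤ P.real {x | 1 / 2 ≤ g x} := measureReal_mono hS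
  linarith

/-- Testing with `g_k = tailFun k` and then with `t g_k` bounds the integrals of `g_k` against both
measures by a quantity that depends only on the data and tends to `0`. -/
theorem exists_tail_bound (hT : 0 < T) (hb : IsCoefficient T O A b)
    (hσ : IsCoefficient T O A fun p => (σ p : ℝ)) (m₀ : ProbabilityMeasure O) :
    ∃ w : ℕ → ℝ≥0, Tendsto w atTop (𝓝 0) ∧
      ∀ (μ : ProbabilityMeasure (Icc (0 : ℝ) T × closure O))
        (ν : FiniteMeasure (Icc (0 : ℝ) T × closure O × A)),
        (∀ u ut ux uxx : ℝ → ℝ → ℝ, IsC12b T O u ut ux uxx →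
          SatisfiesConstraint b σ m₀ μ ν u ut ux uxx) →
        ∀ n : ℕ, μ (univ ×ˢ {x : closure O | |(x : ℝ)| ≤ n + 1})ᶜ ≤ w n ∧
          ν (univ ×ˢ ({x : closure O | |(x : ℝ)| ≤ n + 1} ×ˢ univ))ᶜ ≤ w n := by
  obtain ⟨B, hB⟩ := hb.bounded
  obtain ⟨D, hD⟩ := hσ.bounded
  -- `C / k` bounds `|b g_k' + (σ²/2) g_k''|`, since `|g_k'| ≤ 1 / k` and `|g_k''| ≤ 6 / k`
  obtain ⟨C, hC⟩ : ∃ C, C = |B| + 3 * D ^ 2 := ⟨_, rfl⟩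
  have hC0 : 0 ≤ C := by rw [hC]; positivity
  let r : ℕ → ℝ := fun n => ∫ x : O, tailFun (n + 1) x ∂(m₀ : Measure O) + T * (C / (n + 1))
  have hr0 : ∀ n, T * (C / (n + 1)) ≤ r n := fun n =>
    le_add_of_nonneg_left (integral_nonneg fun x => tailFun_nonneg _ _)
  have hrlim : Tendsto r atTop (𝓝 0) := by
    have := (tendsto_integral_tailFun (m₀ : Measure O)).add
      ((tendsto_one_div_add_atTop_nhds_zero_nat (𝕜 := ℝ)).const_mul (T * C))
    simp only [mul_zero, add_zero] at this
    refine this.congr fun n => ?_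
    simp only [r]
    ring
  -- the integral of `g_k` is at most `r n` against `μ` and at most `2 * T * r n` against `ν`; the
  -- tails cost another factor `2`, as `g_k ≥ 1 / 2` there
  refine ⟨fun n => ((2 + 4 * T) * r n).toNNReal, ?_, fun μ ν h n => ?_⟩
  · simpa using tendsto_real_toNNReal (hrlim.const_mul (2 + 4 * T))
  have hfst := fst_le_timeMeasure hT h
  have hmass : (ν : Measure (Icc (0 : ℝ) T × closure O × A)).real univ ≤ T := by
    have := mass_le_of_fst_le hfst
    rw [← NNReal.coe_le_coe, Real.coe_toNNReal _ hT.le] at this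
    exact this
  obtain ⟨k, hkn⟩ : ∃ k : ℝ, k = n + 1 := ⟨_, rfl⟩
  have hrn : r n = ∫ x : O, tailFun k x ∂(m₀ : Measure O) + T * (C / k) := by rw [hkn]
  have hrn0 := hr0 n
  rw [← hkn] at hrn0 ⊢
  have hk1 : 1 ≤ k := by rw [hkn]; linarith [n.cast_nonneg (α := ℝ)]
  have hk : 0 < k := by linarith
  have hCk : 0 ≤ C / k := by positivity
  have hTCk : 0 ≤ T * (C / k) := by positivity
  -- the drift and diffusion terms of the generator applied to `tailFun k`
  let L : Icc (0 : ℝ) T × closure O × A → ℝ := fun q =>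
    b (q.1, q.2.1, q.2.2) * tailDeriv k q.2.1 +
      (σ (q.1, q.2.1, q.2.2) : ℝ) ^ 2 / 2 * tailDeriv2 k q.2.1
  have hL : ∀ q, |L q| ≤ C / k := by
    intro q
    have h1 : |b (q.1, q.2.1, q.2.2)| ≤ |B| := (hB _).trans (le_abs_self B)
    have h2 : (σ (q.1, q.2.1, q.2.2) : ℝ) ^ 2 ≤ D ^ 2 := by
      have := hD (q.1, q.2.1, q.2.2)
      rw [abs_of_nonneg (NNReal.coe_nonneg _)] at this
      gcongr
    calc |L q| ≤ |b (q.1, q.2.1, q.2.2) * tailDeriv k q.2.1| +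
          |(σ (q.1, q.2.1, q.2.2) : ℝ) ^ 2 / 2 * tailDeriv2 k q.2.1| := abs_add_le _ _
      _ ≤ |B| * (1 / k) + D ^ 2 / 2 * (6 / k) := by
          rw [abs_mul, abs_mul, abs_of_nonneg (show
            0 ≤ (σ (q.1, q.2.1, q.2.2) : ℝ) ^ 2 / 2 by positivity)]
          gcongr
          · exact abs_tailDeriv_le hk _
          · exact abs_tailDeriv2_le hk1 _
      _ = C / k := by rw [hC]; ring
  have hCbound : ∀ x : ℝ, |tailFun k x| ≤ 6 ∧ |tailDeriv k x| ≤ 6 ∧ |tailDeriv2 k x| ≤ 6 :=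
    fun x => ⟨(abs_tailFun_le k x).trans (by norm_num),
      (abs_tailDeriv_le hk x).trans (((div_le_one hk).2 hk1).trans (by norm_num)),
      (abs_tailDeriv2_le hk1 x).trans (div_le_self (by norm_num) hk1)⟩
  have htest := fun (φ φ' : ℝ → ℝ) (hφ : ∀ t, HasDerivAt φ (φ' t) t) (hφ' : Continuous φ') =>
    isC12b_mul (T := T) (O := O) hφ hφ' (hasDerivAt_tailFun hk) (hasDerivAt_tailDeriv hk)
      (continuous_tailDeriv2 hk) (fun x => (hCbound x).1) (fun x => (hCbound x).2.1)
      (fun x => (hCbound x).2.2)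
  have hone := htest (fun _ => 1) (fun _ => 0) (fun t => hasDerivAt_const t 1) continuous_const
  have hid := htest id (fun _ => 1) hasDerivAt_id continuous_const
  have hLm : Measurable L := by
    refine (congrArg Measurable (funext fun q => ?_)).mp
      (isCaratheodory_generatorFun hb hσ hone).measurable
    simp only [L, generatorFun, zero_mul, one_mul, zero_add]
  have hgμ : Integrable (fun z : Icc (0 : ℝ) T × closure O => tailFun k z.2) (μ : Measure _) :=
    Integrable.of_bound ((continuous_tailFun hk).comp (by fun_prop)).aestronglyMeasurable 1
      (Eventually.of_forall fun z => abs_tailFun_le _ _)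
  have hgν : Integrable (fun q : Icc (0 : ℝ) T × closure O × A => tailFun k q.2.1)
      (ν : Measure _) :=
    Integrable.of_bound ((continuous_tailFun hk).comp (by fun_prop)).aestronglyMeasurable 1
      (Eventually.of_forall fun z => abs_tailFun_le _ _)
  have hμr : ∫ z : Icc (0 : ℝ) T × closure O, tailFun k z.2 ∂(μ : Measure _) ≤ r n := by
    have := h _ _ _ _ hone
    simp only [SatisfiesConstraint, generatorFun, one_mul, zero_mul, zero_add] at this
    rw [this, hrn]
    gcongr
    have hLint : ‖∫ q, L q ∂(ν : Measure (Icc (0 : ℝ) T × closure O × A))‖ ≤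
        C / k * (ν : Measure (Icc (0 : ℝ) T × closure O × A)).real univ :=
      norm_integral_le_of_norm_le_const (Eventually.of_forall hL)
    refine (Real.le_norm_self _).trans (hLint.trans ?_)
    rw [mul_comm]
    gcongr
  have hνr : ∫ q : Icc (0 : ℝ) T × closure O × A, tailFun k q.2.1 ∂(ν : Measure _) ≤
      2 * T * r n := by
    have := h _ _ _ _ hid
    simp only [SatisfiesConstraint, generatorFun, one_mul, zero_mul, zero_add, id,
      integral_zero] at this
    have hsplit : ∀ q : Icc (0 : ℝ) T × closure O × A, tailFun k q.2.1 +
        (b (q.1, q.2.1, q.2.2) * (q.1 * tailDeriv k q.2.1) +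
          (σ (q.1, q.2.1, q.2.2) : ℝ) ^ 2 / 2 * (q.1 * tailDeriv2 k q.2.1)) =
        tailFun k q.2.1 + q.1 * L q := fun q => by simp only [L]; ring
    simp only [hsplit] at this
    have htL : ∀ q : Icc (0 : ℝ) T × closure O × A, ‖(q.1 : ℝ) * L q‖ ≤ T * (C / k) := fun q => by
      rw [norm_mul, Real.norm_of_nonneg q.1.2.1]
      exact mul_le_mul q.1.2.2 (hL q) (norm_nonneg _) hT.le
    have htLi : Integrable (fun q : Icc (0 : ℝ) T × closure O × A => (q.1 : ℝ) * L q)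
        (ν : Measure _) :=
      Integrable.of_bound
        ((measurable_subtype_coe.comp measurable_fst).mul hLm).aestronglyMeasurable _
        (Eventually.of_forall htL)
    rw [integral_add hgν htLi] at this
    have h1 : ∫ z : Icc (0 : ℝ) T × closure O, (z.1 : ℝ) * tailFun k z.2 ∂(μ : Measure _) ≤
        T * ∫ z : Icc (0 : ℝ) T × closure O, tailFun k z.2 ∂(μ : Measure _) := by
      rw [← integral_const_mul]
      refine integral_mono_of_nonneg (Eventually.of_forall fun z =>
        mul_nonneg z.1.2.1 (tailFun_nonneg _ _)) (hgμ.const_mul T)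
        (Eventually.of_forall fun z => ?_)
      exact mul_le_mul_of_nonneg_right z.1.2.2 (tailFun_nonneg _ _)
    have h2 : |∫ q : Icc (0 : ℝ) T × closure O × A, (q.1 : ℝ) * L q ∂(ν : Measure _)| ≤
        T * (C / k) * T :=
      (norm_integral_le_of_norm_le_const (Eventually.of_forall htL)).trans (by gcongr)
    have h3 := (abs_le.1 h2).1
    have h4 := mul_le_mul_of_nonneg_left hμr hT.le
    have h5 := mul_le_mul_of_nonneg_left hrn0 hT.le
    linarith
  have hrn' : 0 ≤ r n := hTCk.trans hrn0
  have hTr : 0 ≤ T * r n := by positivity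
  have hμS := measureReal_le_two_mul_integral (S := (univ ×ˢ {x : closure O | |(x : ℝ)| ≤ k})ᶜ)
    hgμ (fun z => tailFun_nonneg _ _) fun z hz =>
      half_le_tailFun hk (not_le.1 (show ¬ |(z.2 : ℝ)| ≤ k by simpa using hz)).le
  have hνS := measureReal_le_two_mul_integral
    (S := (univ ×ˢ ({x : closure O | |(x : ℝ)| ≤ k} ×ˢ (univ : Set A)))ᶜ)
    hgν (fun z => tailFun_nonneg _ _) fun z hz =>
      half_le_tailFun hk (not_le.1 (show ¬ |(z.2.1 : ℝ)| ≤ k by simpa using hz)).le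
  constructor
  · refine NNReal.le_toNNReal_of_coe_le (le_trans hμS ?_)
    linarith
  · refine NNReal.le_toNNReal_of_coe_le (le_trans hνS ?_)
    linarith

end Estimates

/-! ### Compactness of the constraint set -/

theorem mainTheorem5 (T : ℝ) (hT : 0 < T) (O : Set ℝ) (hO : IsOpen O) (A : Set ℝ)
    (hA : IsCompact A) (b : Icc (0 : ℝ) T × ℝ × A → ℝ) (σ : Icc (0 : ℝ) T × ℝ × A → ℝ≥0)
    (hb : IsCoefficient T O A b) (hσ : IsCoefficient T O A fun p => (σ p : ℝ))
    (m₀ : ProbabilityMeasure O)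
    (hm₀ : Integrable (fun x : O => Real.log (1 + |(x : ℝ)|)) (m₀ : Measure O)) :
    IsCompact (constraintSet T O A b σ m₀) := by
  have : CompactSpace A := isCompact_iff_compactSpace.1 hA
  obtain ⟨w, hw, htail⟩ := exists_tail_bound hT hb hσ m₀
  let K : ℕ → Set (closure O) := fun n => {x | |(x : ℝ)| ≤ n + 1}
  have hK : ∀ n, IsCompact (K n) := fun n => by
    have h := (isClosed_closure (s := O)).isClosedEmbedding_subtypeVal.isCompact_preimage
      (isCompact_Icc (a := -((n : ℝ) + 1)) (b := n + 1))
    convert h using 1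
    ext x
    exact abs_le (a := (x : ℝ))
  have hKA : ∀ n, IsCompact (K n ×ˢ (univ : Set A)) := fun n => (hK n).prod isCompact_univ
  let S₁ : Set (ProbabilityMeasure (Icc (0 : ℝ) T × closure O)) :=
    {μ | ∀ n, μ (univ ×ˢ K n)ᶜ ≤ w n}
  have hS₁ : IsCompact S₁ := isCompact_setOfPred_probabilityMeasure_mass_eq_compl_isCompact_le hw
    (fun n => isCompact_univ.prod (hK n)) (Or.inl inferInstance)
  let S₂ : Set (FiniteMeasure (Icc (0 : ℝ) T × closure O × A)) :=
    {ν | (ν : Measure (Icc (0 : ℝ) T × closure O × A)).fst ≤ timeMeasure T ∧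
      ∀ n, ν (univ ×ˢ (K n ×ˢ univ))ᶜ ≤ w n}
  have hS₂ : IsCompact S₂ := by
    have h := (isCompact_setOfPred_finiteMeasure_mass_le_compl_isCompact_le T.toNNReal hw
      (K := fun n => (univ : Set (Icc (0 : ℝ) T)) ×ˢ (K n ×ˢ (univ : Set A)))
      (fun n => isCompact_univ.prod (hKA n)) (Or.inl inferInstance)).inter_right
        (isClosed_setOf_fst_le (Z := closure O × A) (timeMeasure T))
    convert h using 1
    ext ν
    exact ⟨fun h => ⟨⟨mass_le_of_fst_le h.1, h.2⟩, h.1⟩, fun h => ⟨h.2, h.1.2⟩⟩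
  have hS : IsCompact (S₁ ×ˢ S₂) := hS₁.prod hS₂
  have hclosed : ∀ u ut ux uxx : ℝ → ℝ → ℝ, IsC12b T O u ut ux uxx →
      IsClosed ((S₁ ×ˢ S₂) ∩ {p | SatisfiesConstraint b σ m₀ p.1 p.2 u ut ux uxx}) := by
    intro u ut ux uxx hu
    have hcar := isCaratheodory_generatorFun hb hσ hu
    obtain ⟨C, hC⟩ := hcar.bounded
    obtain ⟨D, hD⟩ := hu.cb.2
    let v : BoundedContinuousFunction (Icc (0 : ℝ) T × closure O) ℝ :=
      .ofNormedAddCommGroup (fun z => u z.1 z.2) hu.cb.continuous_subtype D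
        fun z => hD _ z.1.2 _ z.2.2
    have hv : Continuous fun μ : ProbabilityMeasure (Icc (0 : ℝ) T × closure O) =>
        ∫ z, u z.1 z.2 ∂(μ : Measure (Icc (0 : ℝ) T × closure O)) :=
      ProbabilityMeasure.continuous_integral_boundedContinuousFunction v
    have hF : ContinuousOn (fun ν : FiniteMeasure (Icc (0 : ℝ) T × closure O × A) =>
        ∫ q, generatorFun b σ ut ux uxx q ∂(ν : Measure (Icc (0 : ℝ) T × closure O × A))) S₂ :=
      continuousOn_integral_of_caratheodory (timeMeasure T) hKA hw hcar.measurable hC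
        hcar.continuous
    have hcont : ContinuousOn (fun p : ProbabilityMeasure (Icc (0 : ℝ) T × closure O) ×
        FiniteMeasure (Icc (0 : ℝ) T × closure O × A) =>
        ∫ z, u z.1 z.2 ∂(p.1 : Measure (Icc (0 : ℝ) T × closure O)) -
          (∫ x, u 0 x ∂(m₀ : Measure O) + ∫ q, generatorFun b σ ut ux uxx q
            ∂(p.2 : Measure (Icc (0 : ℝ) T × closure O × A)))) (S₁ ×ˢ S₂) :=
      (hv.comp continuous_fst).continuousOn.sub
        (continuousOn_const.add (hF.comp continuousOn_snd fun p hp => hp.2))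
    have h := hcont.preimage_isClosed_of_isClosed hS.isClosed (isClosed_singleton (x := 0))
    convert h using 2
    ext p
    exact sub_eq_zero.symm
  -- the image of `constraintSet` among pairs of measures
  let R : Set (ProbabilityMeasure (Icc (0 : ℝ) T × closure O) ×
      FiniteMeasure (Icc (0 : ℝ) T × closure O × A)) :=
    {p | p ∈ S₁ ×ˢ S₂ ∧ ∀ u ut ux uxx : ℝ → ℝ → ℝ, IsC12b T O u ut ux uxx →
      SatisfiesConstraint b σ m₀ p.1 p.2 u ut ux uxx}
  have hR : IsCompact R := by
    have h := hS.inter_right (isClosed_iInter fun u => isClosed_iInter fun ut =>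
      isClosed_iInter fun ux => isClosed_iInter fun uxx => isClosed_iInter fun hu =>
        hclosed u ut ux uxx hu)
    convert h using 1
    ext p
    simp only [R, mem_inter_iff, mem_iInter, mem_ofPred_eq]
    exact ⟨fun h => ⟨h.1, fun u ut ux uxx hu => ⟨h.1, h.2 u ut ux uxx hu⟩⟩,
      fun h => ⟨h.1, fun u ut ux uxx hu => (h.2 u ut ux uxx hu).2⟩⟩
  have hind : Topology.IsInducing (Prod.map id FlowSpace.toFiniteMeasure :
      ProbabilityMeasure (Icc (0 : ℝ) T × closure O) × FlowSpace T O A → _) :=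
    Topology.IsInducing.id.prodMap ⟨rfl⟩
  have hpre : constraintSet T O A b σ m₀ = Prod.map id FlowSpace.toFiniteMeasure ⁻¹' R := by
    ext ⟨μ, m⟩
    rw [mem_constraintSet_iff hb hσ]
    exact ⟨fun h => ⟨⟨fun n => (htail μ _ h n).1,
      fst_le_timeMeasure hT h, fun n => (htail μ _ h n).2⟩, h⟩, fun h => h.2⟩
  rw [hpre]
  refine (hind.isCompact_preimage_iff ?_).2 hR
  -- `R` lies in the range because the time marginals in `S₂` are dominated by `dt`
  rintro ⟨μ, ν⟩ hp
  obtain ⟨m, rfl⟩ := exists_toFiniteMeasure_eq hA.isClosed ν hp.1.2.1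
  exact ⟨(μ, m), rfl⟩
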